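/- Let $d\in\mathbb N$ and let $P^x=\bigotimes_{i\in\mathbb Z^d}P_i^{x_i}$ be the product, on $C(\mathbb R_+,\mathbb R)^{\mathbb Z^d}$, of Wiener measures started at $x_i$, for $x\in\mathbb R^{\mathbb Z^d}$. Write $(\theta_t\omega)(s)=\omega(t-s)$, $0\le s\le t$. **Interaction.** Let $\varphi=(\varphi_A)_A$, $A\subset\mathbb Z^d$ finite, be functions $\varphi_A:\mathbb R^{\mathbb Z^d}\to\mathbb R$ such that $\varphi_A$ is measurable with respect to the coordinates in $A$ and Lipschitz continuous in them, $\sum_{A\ni i}\|\varphi_A\|_\infty<\infty$ for every $i$, $\varphi_{A+i}(\tau_ix)=\varphi_A(x)$ with $(\tau_ix)_j=x_{j-i}$, and, for some $r>0$, $\varphi_A\equiv0$ whenever $\operatorname{diam}(A)>r$. **Drift.** Let $\mathcal N\subset\mathbb Z^d$ be finite with $0\in\mathcal N$, and let $b_0(t,\omega)$ be a jointly measurable functional that depends only on $(\omega_j(s))_{j\in\mathcal N,\,0\le s\le t}$ and such that for every $T>0$ there is $K(T)>0$ with $|b_0(t,\omega)-b_0(t,\omega')|\le K(T)\sup_{0\le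 s\le t,\,j\in\mathcal N}|\omega_j(s)-\omega'_j(s)|$ for all $t\le T$ and all $\omega,\omega'$. Let $N$ be a natural number with $|\mathcal N|\le N$ and $\varphi_A\equiv0$ whenever $|A|>N$, and let $p$ be the smallest odd integer larger than $N$. Put $$F^t(X)=\int_0^tb_0(s,X)\,dX_0(s)-\tfrac12\int_0^tb_0(s,X)^2\,ds ,$$ and assume that for every $t>0$ the time-reversed functional $F^t\circ\theta_t$ is well defined $P^x$-almost surely for every $x$ (the stochastic integral being the limit in probability of the left-point sums along the reversed path, for partitions of mesh tending to $0$ whose associated step processes approximate the integrand in $L^2([0,t])$ in probability), and that $$\lim_{t\to0}\ \sup_{x\in\mathbb R^{\mathbb Z^d}}E_{P^x}\Big[\big(\exp|F^t\circ\theta_t|-1\big)^{2p}\Big]=0 .$$ **Clusters.** For finite $A\subset\mathbb Z^d$ put $$\Psi_A(t,X)=\Phi^t_A(X)+\varphi_A(X(t))-\varphi_A(X(0)),$$ where $\Phi^t_{\mathcal N+i}(X)=-F^t(\theta_tX_{\cdot+i})$ for $i\in\mathbb Z^d$, and $\Phi^t_A=0$ if $A$ is not a translate of $\mathcal N$. A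 cluster is a nonempty finite collection $\gamma=\{A_1,\dots,A_n\}$ of nonempty sets $A_k\subset\mathbb Z^d$ with $|A_k|\le N$, any two of which are joined by a chain of members of $\gamma$ in which consecutive sets intersect; it is a cluster in $\Lambda$ if all $A_k\subset\Lambda$, and $|\gamma|$ denotes the cardinality of $A_1\cup\dots\cup A_n$. The weight of $\gamma$ is $$w^t(\gamma,x)=E_{P^x}\Big[\prod_{A\in\gamma}\big(e^{-\Psi_A(t,X)}-1\big)\Big].$$ **Lemma.** There are $t_0>0$ and a strictly positive function $\lambda$ with $\lambda(t)\to0$ as $t\to0$ such that for all $0<t\le t_0$, all finite $\Lambda\subset\mathbb Z^d$, all clusters $\gamma$ in $\Lambda$ and all $x\in\mathbb R^{\mathbb Z^d}$ the product defining $w^t(\gamma,x)$ is $P^x$-integrable and $$|w^t(\gamma,x)|\le\lambda(t)^{|\gamma|}.$$ -/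

import Mathlib

open MeasureTheory ProbabilityTheory Filter Topology
open scoped NNReal ENNReal

noncomputable section

namespace ShortTimeGibbs

/-- Sites of the lattice `ℤ^d`. -/
abbrev Site (d : ℕ) : Type := Fin d → ℤ

/-- Spin configurations `ℝ^{ℤ^d}`. -/
abbrev Config (d : ℕ) : Type := Site d → ℝ

/-- The canonical sigma-field on continuous trajectories: the one generated by the evaluations
`ω ↦ ω s`. -/
instance trajectoryMeasurableSpace : MeasurableSpace C(ℝ≥0, ℝ) :=
  MeasurableSpace.comap (fun (ω : C(ℝ≥0, ℝ)) (s : ℝ≥0) => ω s) MeasurableSpace.pi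

/-- The path space `C(ℝ₊, ℝ)^{ℤ^d}`, with its product sigma-field. -/
abbrev PathSpace (d : ℕ) : Type := Site d → C(ℝ≥0, ℝ)

/-- The translate `A + i` of a finite set of sites. -/
def translate {d : ℕ} (i : Site d) (A : Finset (Site d)) : Finset (Site d) :=
  A.image (fun j => j + i)

/-- A nonempty finite set of sites determines the vector by which it has been translated. -/
theorem translate_left_injective {d : ℕ} {A : Finset (Site d)} (hA : A.Nonempty)
    {i i' : Site d} (h : translate i A = translate i' A) : i = i' := by
  have key : ∀ k : Site d, ∑ j ∈ translate k A, j = (∑ j ∈ A, j) + A.card • k := by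
    intro k
    rw [translate, Finset.sum_image (fun a _ b _ hab => add_right_cancel hab),
      Finset.sum_add_distrib, Finset.sum_const]
  have h2 : A.card • i = A.card • i' := by
    have h1 := key i
    rw [h, key i'] at h1
    exact (add_left_cancel h1).symm
  funext a
  have h3 := congrFun h2 a
  simp only [Pi.smul_apply, nsmul_eq_mul] at h3
  exact mul_left_cancel₀ (Nat.cast_ne_zero.mpr hA.card_ne_zero) h3

/-! ### Interactions -/

/-- An interaction: a translation invariant, absolutely summable family of local functions. -/
structure IsInteraction {d : ℕ} (φ : Finset (Site d) → Config d → ℝ) : Prop where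
  /-- `φ_A` is measurable for the sigma-field generated by the coordinates in `A`. -/
  local_measurable : ∀ A : Finset (Site d),
    Measurable[cylinderEvents (X := fun _ : Site d => ℝ) (A : Set (Site d))] (φ A)
  summable : ∀ i : Site d,
    (∑' A : {A : Finset (Site d) // i ∈ A}, ⨆ x : Config d, ‖φ A x‖ₑ) ≠ ∞
  /-- `φ_{A+i}(τ_i x) = φ_A(x)` with `(τ_i x)_j = x_{j-i}`. -/
  translation_invariant : ∀ (A : Finset (Site d)) (i : Site d) (x : Config d),
    φ (translate i A) (fun j => x (j - i)) = φ A x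

/-- Finite range: `φ_A` vanishes as soon as the diameter of `A` exceeds some `r > 0`. -/
def HasFiniteRange {d : ℕ} (φ : Finset (Site d) → Config d → ℝ) : Prop :=
  ∃ r : ℝ, 0 < r ∧ ∀ A : Finset (Site d), r < Metric.diam (A : Set (Site d)) → ∀ x, φ A x = 0

/-- Every `φ_A` is a Lipschitz continuous function of the coordinates in `A` (the distance on
`ℝ^A` is the one of the supremum norm). -/
def IsLipschitzInteraction {d : ℕ} (φ : Finset (Site d) → Config d → ℝ) : Prop :=
  ∀ A : Finset (Site d), ∃ C : ℝ, ∀ x y : Config d,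
    |φ A x - φ A y| ≤ C * dist (A.restrict x) (A.restrict y)

/-! ### Wiener measure, time reversal, shifts -/

/-- `W` is the Wiener measure on `C(ℝ₊, ℝ)` started at `0`: under `W` the coordinate process is
a standard Brownian motion. -/
def IsWienerMeasure (W : Measure C(ℝ≥0, ℝ)) : Prop :=
  IsBrownianReal (fun (t : ℝ≥0) (ω : C(ℝ≥0, ℝ)) => ω t) W

/-- The product `P^x = ⊗_i P_i^{x_i}` of the Wiener measures started at `x_i`, where `W` is the
Wiener measure started at `0`. -/
def wienerFrom {d : ℕ} (W : Measure C(ℝ≥0, ℝ)) (x : Config d) : Measure (PathSpace d) :=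
  Measure.infinitePi
    (fun i : Site d => W.map (fun ω : C(ℝ≥0, ℝ) => ω + ContinuousMap.const ℝ≥0 (x i)))

/-- Time reversal on `[0, t]`: `(θ_t ω)(s) = ω(t - s)` for `s ≤ t`. The subtraction of `ℝ≥0` is
truncated, so the reversed path stays constant after time `t`. -/
def timeReversal {d : ℕ} (t : ℝ≥0) (ω : PathSpace d) : PathSpace d :=
  fun i => ⟨fun s => ω i (t - s), by fun_prop⟩

/-- The shifted family of paths `X_{· + i}`. -/
def shiftPath {d : ℕ} (i : Site d) (ω : PathSpace d) : PathSpace d :=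
  fun j => ω (j + i)

/-! ### Stochastic integrals -/

/-- A finite partition `0 = s_0 ≤ s_1 ≤ ⋯ ≤ s_n = t` of `[0, t]`. -/
structure TimePartition (t : ℝ≥0) where
  n : ℕ
  pt : ℕ → ℝ≥0
  mono : Monotone pt
  pt_zero : pt 0 = 0
  pt_last : pt n = t

/-- The mesh size of a partition. -/
def TimePartition.mesh {t : ℝ≥0} (π : TimePartition t) : ℝ≥0 :=
  (Finset.range π.n).sup (fun j => π.pt (j + 1) - π.pt j)

/-- The left-point sum `∑_j H(s_j) (Y(s_{j+1}) - Y(s_j))`. -/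
def TimePartition.leftSum {t : ℝ≥0} {Ω : Type*} (π : TimePartition t) (H Y : ℝ≥0 → Ω → ℝ)
    (ω : Ω) : ℝ :=
  ∑ j ∈ Finset.range π.n, H (π.pt j) ω * (Y (π.pt (j + 1)) ω - Y (π.pt j) ω)

/-- The simple process equal to `H(s_j)` on `(s_j, s_{j+1}]`. -/
def TimePartition.leftStep {t : ℝ≥0} {Ω : Type*} (π : TimePartition t) (H : ℝ≥0 → Ω → ℝ)
    (s : ℝ≥0) (ω : Ω) : ℝ :=
  ∑ j ∈ Finset.range π.n,
    Set.indicator (Set.Ioc (π.pt j) (π.pt (j + 1))) (fun _ => H (π.pt j) ω) s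

/-- A sequence of partitions of `[0, t]` whose mesh tends to `0` and along which the simple
processes built from the integrand `H` approximate `H` in `L²([0, t])`, in `μ`-probability.
(If `H` has continuous trajectories, every sequence with mesh tending to `0` is of this kind.) -/
def IsApproximating {t : ℝ≥0} {Ω : Type*} [MeasurableSpace Ω] (μ : Measure Ω)
    (H : ℝ≥0 → Ω → ℝ) (π : ℕ → TimePartition t) : Prop :=
  Tendsto (fun k => (π k).mesh) atTop (𝓝 0) ∧
    ∀ ε : ℝ≥0∞, 0 < ε →
      Tendsto (fun k => μ {ω | ε ≤ ∫⁻ s in Set.Ioc (0 : ℝ) t,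
        ‖(π k).leftStep H s.toNNReal ω - H s.toNNReal ω‖ₑ ^ 2}) atTop (𝓝 0)

/-- `I` is (a version of) the stochastic integral `∫_0^t H(s) dY(s)` under `μ`: the limit in
`μ`-probability of the left-point sums as the mesh of the partition tends to `0`. -/
def IsStochIntegral {Ω : Type*} [MeasurableSpace Ω] (μ : Measure Ω) (t : ℝ≥0)
    (H Y : ℝ≥0 → Ω → ℝ) (I : Ω → ℝ) : Prop :=
  (∃ π : ℕ → TimePartition t, IsApproximating μ H π) ∧
    ∀ π : ℕ → TimePartition t, IsApproximating μ H π →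
      TendstoInMeasure μ (fun k => (π k).leftSum H Y) atTop I

/-! ### The drift -/

/-- The drift `b_0` at the origin is finite-range, adapted (and jointly measurable), and Lipschitz
continuous uniformly on compact time intervals. The drift at the site `i` is
`b_i(t, ω) = b_0(t, ω_{·+i})`. -/
structure IsAdmissibleDrift {d : ℕ} (𝒩 : Finset (Site d)) (b₀ : ℝ≥0 → PathSpace d → ℝ) :
    Prop where
  origin_mem : (0 : Site d) ∈ 𝒩
  measurable : Measurable (fun q : ℝ≥0 × PathSpace d => b₀ q.1 q.2)
  /-- `b_0(t, ω) = b_0(t, (ω_𝒩(s) : 0 ≤ s ≤ t))`. -/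
  adapted : ∀ (t : ℝ≥0) (ω ω' : PathSpace d),
    (∀ j ∈ 𝒩, ∀ s ≤ t, ω j s = ω' j s) → b₀ t ω = b₀ t ω'
  lipschitz : ∀ T : ℝ≥0, 0 < T → ∃ K : ℝ, 0 < K ∧ ∀ t ≤ T, ∀ ω ω' : PathSpace d,
    |b₀ t ω - b₀ t ω'| ≤ K * ⨆ q : Set.Iic t × 𝒩, |ω q.2 q.1 - ω' q.2 q.1|

/-- The functional `F^t = ∫_0^t b_0(s, X) dX_0(s) - ½ ∫_0^t b_0(s, X)² ds` has a well-defined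
time reversal under `μ`, and `F` is a version of it: evaluated along the reversed path
`θ_t X`, with `X` of law `μ`, both integrals exist and their combination is `F ∘ θ_t` almost
surely. -/
def IsReversedGirsanov {d : ℕ} (μ : Measure (PathSpace d)) (b₀ : ℝ≥0 → PathSpace d → ℝ)
    (t : ℝ≥0) (F : PathSpace d → ℝ) : Prop :=
  (∀ᵐ ω ∂μ, IntervalIntegrable (fun s : ℝ => b₀ s.toNNReal (timeReversal t ω) ^ 2) volume 0 t) ∧
    ∃ I : PathSpace d → ℝ,
      IsStochIntegral μ t (fun s ω => b₀ s (timeReversal t ω))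
        (fun s ω => timeReversal t ω 0 s) I ∧
      (fun ω => F (timeReversal t ω)) =ᵐ[μ] fun ω =>
        I ω - 1 / 2 * ∫ s in (0 : ℝ)..t, b₀ s.toNNReal (timeReversal t ω) ^ 2

/-- `E_{P^x} [(exp |F^t ∘ θ_t| - 1)^{2p}] → 0` as `t → 0`, uniformly in the initial
condition `x`. -/
def ExponentialMomentCondition {d : ℕ} (W : Measure C(ℝ≥0, ℝ)) (F : ℝ≥0 → PathSpace d → ℝ)
    (p : ℕ) : Prop :=
  Tendsto (fun t : ℝ≥0 => ⨆ x : Config d, ∫⁻ ω,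
    ENNReal.ofReal ((Real.exp |F t (timeReversal t ω)| - 1) ^ (2 * p)) ∂(wienerFrom W x))
    (𝓝[>] 0) (𝓝 0)

/-! ### Clusters and their weights -/

open Classical in
/-- `Φ^t_{𝒩+i}(X) = -F^t(θ_t X_{·+i})`, and `Φ^t_A = 0` if `A` is not a translate of `𝒩`. -/
def girsanovPotential {d : ℕ} (𝒩 : Finset (Site d)) (F : ℝ≥0 → PathSpace d → ℝ) (t : ℝ≥0)
    (A : Finset (Site d)) (ω : PathSpace d) : ℝ :=
  if h : ∃ i : Site d, A = translate i 𝒩 then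
    -F t (timeReversal t (shiftPath h.choose ω)) else 0

/-- `Ψ_A(t, X) = Φ^t_A(X) + φ_A(X(t)) - φ_A(X(0))`. -/
def pathPotential {d : ℕ} (𝒩 : Finset (Site d)) (F : ℝ≥0 → PathSpace d → ℝ)
    (φ : Finset (Site d) → Config d → ℝ) (t : ℝ≥0) (A : Finset (Site d)) (ω : PathSpace d) : ℝ :=
  girsanovPotential 𝒩 F t A ω + φ A (fun i => ω i t) - φ A (fun i => ω i 0)

/-- A cluster: a nonempty finite collection of nonempty finite sets of at most `N` sites, any two
of which are joined by a chain of members of the collection in which consecutive ones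
intersect. -/
structure IsCluster {d : ℕ} (N : ℕ) (γ : Finset (Finset (Site d))) : Prop where
  nonempty : γ.Nonempty
  mem_nonempty : ∀ A ∈ γ, A.Nonempty
  card_le : ∀ A ∈ γ, A.card ≤ N
  connected : ∀ A ∈ γ, ∀ B ∈ γ,
    Relation.ReflTransGen (fun C D => C ∈ γ ∧ D ∈ γ ∧ (C ∩ D).Nonempty) A B

/-- The support of a cluster. -/
def clusterSupport {d : ℕ} (γ : Finset (Finset (Site d))) : Finset (Site d) :=
  γ.biUnion id

/-- `K^t(γ)(X) = ∏_{A ∈ γ} (e^{-Ψ_A(t, X)} - 1)`. -/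
def clusterFunctional {d : ℕ} (𝒩 : Finset (Site d)) (F : ℝ≥0 → PathSpace d → ℝ)
    (φ : Finset (Site d) → Config d → ℝ) (t : ℝ≥0) (γ : Finset (Finset (Site d)))
    (ω : PathSpace d) : ℝ :=
  ∏ A ∈ γ, (Real.exp (-pathPotential 𝒩 F φ t A ω) - 1)

/-- The cluster weight `w^t(γ, x) = E_{P^x} [K^t(γ)]`. -/
def clusterWeight {d : ℕ} (W : Measure C(ℝ≥0, ℝ)) (𝒩 : Finset (Site d))
    (F : ℝ≥0 → PathSpace d → ℝ) (φ : Finset (Site d) → Config d → ℝ) (t : ℝ≥0)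
    (γ : Finset (Finset (Site d))) (x : Config d) : ℝ :=
  ∫ ω, clusterFunctional 𝒩 F φ t γ ω ∂(wienerFrom W x)

end ShortTimeGibbs

end

/-! The factor of a cluster functional attached to `A` is, almost surely, a function of the
independent trajectories in `A`. Sets of a cluster may overlap, so the expectation of the product
does not factorize, but Finner's form of Hölder's inequality (`lintegral_infinitePi_prod_rpow_le`)
bounds it by a product of norms, provided that at every site the inverse exponents of the sets
containing it add up to at most `1`.

Translates of `𝒩` carry a Girsanov term whose moments are controlled only at order `2p`; at most
`|𝒩| < p` of them contain a given site, so the exponent `2p` uses up at most `1/2`. Any other factor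
involves only the interaction. It vanishes if the diameter exceeds `r`, and otherwise all its
moments are available because `φ` is uniformly bounded; only boundedly many such sets contain a
given site, so a large exponent `2M` uses up at most the other `1/2` (`sum_exponents_le_one`).

Each moment is at most `δ t`, a constant times the Girsanov moment plus a multiple of `t`: the
Lipschitz bound reduces the interaction part to Brownian increments, of variance `t`
(`exists_factor_version`). Once `δ t ≤ 1`, every factor contributes at most `ε ^ N` with `ε = δ t ^
(1 / (2MN))`. Since the support has at most `N` sites per set of the cluster, the product is at most
`ε ^ |γ|`. -/

noncomputable section

namespace ShortTimeGibbs

/-! ### Finner's inequality for product probability measures. -/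

section FinnerInequality

variable {δ κ : Type*} [DecidableEq δ] {X : δ → Type*} [∀ i, MeasurableSpace (X i)]

/-- The iterated integral over `s` of a function that does not depend on the coordinate `i` does
not depend on it either. -/
theorem lmarginal_update_of_dependsOn (μ : ∀ i, Measure (X i)) (s : Finset δ)
    {f : (∀ i, X i) → ℝ≥0∞} {D : Set δ} (hf : DependsOn f D) {i : δ} (hi : i ∉ D)
    (x : ∀ i, X i) (y : X i) :
    lmarginal μ s f (Function.update x i y) = lmarginal μ s f x := by
  refine lintegral_congr fun z => hf fun j hj => ?_
  have hne : j ≠ i := fun h => hi (h ▸ hj)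
  simp [Function.updateFinset, Function.update_of_ne hne]

/-- Hölder's inequality with exponents that may fall short of `1`: the missing exponent is given to
the constant function `1`, whose integral is `1`. -/
theorem lintegral_prod_rpow_le_of_sum_le_one {α : Type*} [MeasurableSpace α] (μ : Measure α)
    [IsProbabilityMeasure μ] (S : Finset κ) {f : κ → α → ℝ≥0∞} {θ : κ → ℝ}
    (hf : ∀ a ∈ S, Measurable (f a)) (hθ : ∀ a ∈ S, 0 ≤ θ a) (hsum : ∑ a ∈ S, θ a ≤ 1) :
    ∫⁻ x, ∏ a ∈ S, f a x ^ θ a ∂μ ≤ ∏ a ∈ S, (∫⁻ x, f a x ∂μ) ^ θ a := by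
  simpa using ENNReal.lintegral_mul_prod_norm_pow_le (μ := μ) S (g := fun _ => 1) (f := f)
    aemeasurable_const (fun a ha => (hf a ha).aemeasurable) (1 - ∑ a ∈ S, θ a) (p := θ)
    (by ring) (by linarith) hθ

/-- Finner's generalization of Hölder's inequality, for iterated integrals. -/
theorem lmarginal_prod_rpow_le (μ : ∀ i, Measure (X i)) [∀ i, IsProbabilityMeasure (μ i)]
    (S : Finset κ) {f : κ → (∀ i, X i) → ℝ≥0∞} {D : κ → Finset δ} {θ : κ → ℝ}
    (hf : ∀ a ∈ S, Measurable (f a)) (hD : ∀ a ∈ S, DependsOn (f a) (D a : Set δ))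
    (hθ : ∀ a ∈ S, 0 ≤ θ a) (hsum : ∀ i, ∑ a ∈ S with i ∈ D a, θ a ≤ 1)
    (s : Finset δ) (x : ∀ i, X i) :
    lmarginal μ s (fun y => ∏ a ∈ S, f a y ^ θ a) x ≤ ∏ a ∈ S, (lmarginal μ s (f a) x) ^ θ a := by
  have hmeas : Measurable fun y => ∏ a ∈ S, f a y ^ θ a :=
    Finset.measurable_fun_prod _ fun a ha => (hf a ha).pow_const _
  induction s using Finset.induction generalizing x with
  | empty => simp
  | insert i s hi ih =>
    rw [lmarginal_insert _ hmeas hi]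
    -- Hölder's inequality in the coordinate `i` is needed only for the functions that involve `i`;
    -- the others are constant in it and leave the integral.
    have hsplit (g : κ → ℝ≥0∞) : ∏ a ∈ S, g a =
        (∏ a ∈ S with i ∈ D a, g a) * ∏ a ∈ S with i ∉ D a, g a :=
      (Finset.prod_filter_mul_prod_filter_not S _ g).symm
    have hout : ∀ a ∈ S.filter (i ∉ D ·), ∀ y,
        lmarginal μ s (f a) (Function.update x i y) = lmarginal μ s (f a) x := by
      intro a ha y
      rw [Finset.mem_filter] at ha
      exact lmarginal_update_of_dependsOn μ s (hD a ha.1) (by simpa using ha.2) x y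
    have hmarg : ∀ a ∈ S, Measurable fun y => lmarginal μ s (f a) (Function.update x i y) :=
      fun a ha => ((hf a ha).lmarginal μ).comp (measurable_update x)
    calc ∫⁻ y, lmarginal μ s (fun y => ∏ a ∈ S, f a y ^ θ a) (Function.update x i y) ∂μ i
        ≤ ∫⁻ y, ∏ a ∈ S, lmarginal μ s (f a) (Function.update x i y) ^ θ a ∂μ i :=
          lintegral_mono fun y => ih _
      _ = ∫⁻ y, (∏ a ∈ S with i ∈ D a, lmarginal μ s (f a) (Function.update x i y) ^ θ a) *
            ∏ a ∈ S with i ∉ D a, lmarginal μ s (f a) x ^ θ a ∂μ i := by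
          refine lintegral_congr fun y => ?_
          rw [hsplit]
          congr 1
          exact Finset.prod_congr rfl fun a ha => by rw [hout a ha]
      _ = (∫⁻ y, ∏ a ∈ S with i ∈ D a, lmarginal μ s (f a) (Function.update x i y) ^ θ a ∂μ i) *
            ∏ a ∈ S with i ∉ D a, lmarginal μ s (f a) x ^ θ a := by
          refine lintegral_mul_const _ (Finset.measurable_fun_prod _ fun a ha => ?_)
          exact (hmarg a (Finset.mem_filter.1 ha).1).pow_const _
      _ ≤ (∏ a ∈ S with i ∈ D a,
            (∫⁻ y, lmarginal μ s (f a) (Function.update x i y) ∂μ i) ^ θ a) *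
            ∏ a ∈ S with i ∉ D a, lmarginal μ s (f a) x ^ θ a := by
          gcongr
          exact lintegral_prod_rpow_le_of_sum_le_one (μ i) _
            (fun a ha => hmarg a (Finset.mem_filter.1 ha).1)
            (fun a ha => hθ a (Finset.mem_filter.1 ha).1) (hsum i)
      _ = ∏ a ∈ S, lmarginal μ (insert i s) (f a) x ^ θ a := by
          rw [hsplit]
          congr 1
          · refine Finset.prod_congr rfl fun a ha => ?_
            rw [lmarginal_insert _ (hf a (Finset.mem_filter.1 ha).1) hi]
          -- A function constant in the coordinate `i` is unchanged by integration against the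
          -- probability measure `μ i`.
          · refine Finset.prod_congr rfl fun a ha => ?_
            rw [lmarginal_insert _ (hf a (Finset.mem_filter.1 ha).1) hi]
            simp [hout a ha]

/-- Reduces a function of finitely many coordinates to an iterated integral, on which induction over
the coordinates is possible; the base point `x` plays no role. -/
theorem lintegral_infinitePi_eq_lmarginal (μ : ∀ i, Measure (X i))
    [∀ i, IsProbabilityMeasure (μ i)] {f : (∀ i, X i) → ℝ≥0∞} (hf : Measurable f) {s : Finset δ}
    (hs : DependsOn f (s : Set δ)) (x : ∀ i, X i) :
    ∫⁻ y, f y ∂Measure.infinitePi μ = lmarginal μ s f x := by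
  rw [lmarginal, ← lintegral_restrict_infinitePi μ
    (f := fun y : ∀ i : s, X i => f (Function.updateFinset x s y))
    (hf.comp measurable_updateFinset)]
  refine lintegral_congr fun y => hs fun i hi => ?_
  have hi' : i ∈ s := hi
  simp [Function.updateFinset, hi']

/-- Finner's generalization of Hölder's inequality: if `f_a` depends on the coordinates in `D_a`
and the exponents of the functions that depend on any given coordinate add up to at most `1`,
then the integral of `∏ f_a ^ θ_a` for a product of probability measures is at most
`∏ (∫ f_a) ^ θ_a`. -/
theorem lintegral_infinitePi_prod_rpow_le (μ : ∀ i, Measure (X i))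
    [∀ i, IsProbabilityMeasure (μ i)]
    (S : Finset κ) {f : κ → (∀ i, X i) → ℝ≥0∞} {D : κ → Finset δ} {θ : κ → ℝ}
    (hf : ∀ a ∈ S, Measurable (f a)) (hD : ∀ a ∈ S, DependsOn (f a) (D a : Set δ))
    (hθ : ∀ a ∈ S, 0 ≤ θ a) (hsum : ∀ i, ∑ a ∈ S with i ∈ D a, θ a ≤ 1) :
    ∫⁻ y, ∏ a ∈ S, f a y ^ θ a ∂Measure.infinitePi μ ≤
      ∏ a ∈ S, (∫⁻ y, f a y ∂Measure.infinitePi μ) ^ θ a := by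
  obtain ⟨x⟩ : Nonempty (∀ i, X i) := (Measure.infinitePi μ).nonempty_of_neZero
  have hsub : ∀ a ∈ S, (D a : Set δ) ⊆ (S.biUnion D : Finset δ) := fun a ha =>
    Finset.coe_subset.2 (Finset.subset_biUnion_of_mem D ha)
  have hprod : DependsOn (fun y => ∏ a ∈ S, f a y ^ θ a) ((S.biUnion D : Finset δ) : Set δ) :=
    fun y z hyz => Finset.prod_congr rfl fun a ha => by
      rw [hD a ha fun i hi => hyz i (hsub a ha hi)]
  rw [lintegral_infinitePi_eq_lmarginal μ
    (Finset.measurable_fun_prod _ fun a ha => (hf a ha).pow_const _) hprod x]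
  refine (lmarginal_prod_rpow_le μ S hf hD hθ hsum _ x).trans_eq ?_
  refine Finset.prod_congr rfl fun a ha => ?_
  rw [lintegral_infinitePi_eq_lmarginal μ (hf a ha) ((hD a ha).mono (hsub a ha)) x]

end FinnerInequality

/-! ### Measurability on path space, shifts and Brownian increments. -/

section WienerMeasure

theorem measurable_trajectory_eval (s : ℝ≥0) : Measurable fun ω : C(ℝ≥0, ℝ) => ω s :=
  (measurable_pi_apply s).comp (comap_measurable _)

theorem measurable_trajectory_of_eval {α : Type*} [MeasurableSpace α] {f : α → C(ℝ≥0, ℝ)}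
    (hf : ∀ s, Measurable fun a => f a s) : Measurable f := by
  rw [measurable_comap_iff]
  exact measurable_pi_lambda _ hf

theorem measurable_trajectory_add_const (c : ℝ) :
    Measurable fun ω : C(ℝ≥0, ℝ) => ω + ContinuousMap.const ℝ≥0 c :=
  measurable_trajectory_of_eval fun s => by
    simpa using (measurable_trajectory_eval s).add_const c

theorem measurable_path_eval {d : ℕ} (i : Site d) (s : ℝ≥0) :
    Measurable fun ω : PathSpace d => ω i s :=
  (measurable_trajectory_eval s).comp (measurable_pi_apply i)

theorem measurable_timeReversal {d : ℕ} (t : ℝ≥0) :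
    Measurable (timeReversal t : PathSpace d → PathSpace d) :=
  measurable_pi_lambda _ fun i => measurable_trajectory_of_eval fun s =>
    measurable_path_eval i (t - s)

theorem measurable_shiftPath {d : ℕ} (k : Site d) :
    Measurable (shiftPath k : PathSpace d → PathSpace d) :=
  measurable_pi_lambda _ fun j => measurable_pi_apply (j + k)

variable {W : Measure C(ℝ≥0, ℝ)}

theorem IsWienerMeasure.isProbabilityMeasure (hW : IsWienerMeasure W) : IsProbabilityMeasure W :=
  hW.toIsPreBrownianReal.isGaussianProcess.isProbabilityMeasure

theorem isProbabilityMeasure_trajectory_map [IsProbabilityMeasure W] (c : ℝ) :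
    IsProbabilityMeasure (W.map fun ω : C(ℝ≥0, ℝ) => ω + ContinuousMap.const ℝ≥0 c) :=
  Measure.isProbabilityMeasure_map (measurable_trajectory_add_const c).aemeasurable

/-- The shifted family of independent Brownian motions starts at the shifted configuration. -/
theorem wienerFrom_map_shiftPath [IsProbabilityMeasure W] {d : ℕ} (x : Config d) (k : Site d) :
    (wienerFrom W x).map (shiftPath k) = wienerFrom W fun j => x (j + k) := by
  have hprob (i : Site d) := isProbabilityMeasure_trajectory_map (W := W) (x i)
  refine Measure.eq_infinitePi (hμ := fun i => hprob (i + k)) _ fun s T hT => ?_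
  rw [Measure.map_apply (measurable_shiftPath k)
    (MeasurableSet.pi s.countable_toSet fun i _ => hT i), wienerFrom]
  have : shiftPath k ⁻¹' (s : Set (Site d)).pi T =
      ((s.image (· + k) : Finset (Site d)) : Set (Site d)).pi fun i => T (i - k) := by
    ext ω
    simp only [shiftPath, Set.mem_preimage, Set.mem_pi, Finset.coe_image, Set.mem_image,
      Finset.mem_coe, forall_exists_index, and_imp, forall_apply_eq_imp_iff₂, add_sub_cancel_right]
  rw [this, Measure.infinitePi_pi _ fun i _ => hT (i - k),
    Finset.prod_image fun a _ b _ h => add_right_cancel h]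
  simp

/-- The increments of the coordinates have variance `t`. -/
theorem lintegral_increment_sq (hW : IsWienerMeasure W) {d : ℕ} (x : Config d) (i : Site d)
    (t : ℝ≥0) :
    ∫⁻ ω, ENNReal.ofReal ((ω i t - ω i 0) ^ 2) ∂wienerFrom W x = t := by
  have := hW.isProbabilityMeasure
  have hprob (i : Site d) := isProbabilityMeasure_trajectory_map (W := W) (x i)
  have hB := hW.toIsPreBrownianReal
  have hinc : Measurable fun ω : C(ℝ≥0, ℝ) => ENNReal.ofReal ((ω t - ω 0) ^ 2) :=
    (((measurable_trajectory_eval t).sub (measurable_trajectory_eval 0)).pow_const 2).ennreal_ofReal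
  have h1 : ∫⁻ ω, ENNReal.ofReal ((ω i t - ω i 0) ^ 2) ∂wienerFrom W x =
      ∫⁻ ω, ENNReal.ofReal ((ω t - ω 0) ^ 2)
        ∂(W.map fun ω : C(ℝ≥0, ℝ) => ω + ContinuousMap.const ℝ≥0 (x i)) :=
    (measurePreserving_eval_infinitePi (fun i : Site d =>
      W.map fun ω : C(ℝ≥0, ℝ) => ω + ContinuousMap.const ℝ≥0 (x i)) i).lintegral_comp hinc
  rw [h1, lintegral_map hinc (measurable_trajectory_add_const _)]
  have h2 : ∫⁻ ω : C(ℝ≥0, ℝ), ENNReal.ofReal ((ω t) ^ 2) ∂W = t := by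
    have hL := hB.hasLaw_eval t
    have hmem : MemLp (fun ω : C(ℝ≥0, ℝ) => ω t) 2 W :=
      (hB.isGaussianProcess.hasGaussianLaw_eval t).memLp_two
    have hvar : Var[fun ω : C(ℝ≥0, ℝ) => ω t; W] = t := by
      rw [hL.variance_eq, variance_id_gaussianReal]
    rw [variance_of_integral_eq_zero hmem.aemeasurable (hB.integral_eval t)] at hvar
    rw [← ofReal_integral_eq_lintegral_ofReal hmem.integrable_sq
      (Eventually.of_forall fun _ => sq_nonneg _), hvar, ENNReal.ofReal_coe_nnreal]
  rw [← h2]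
  refine lintegral_congr_ae ?_
  filter_upwards [hB.eval_zero_ae_eq_zero] with ω hω
  simp [hω]

end WienerMeasure

/-! ### A measurable and local version of the reversed Girsanov functional. -/

section Drift

/-- The time reversal of the Girsanov functional has a version that is a measurable function of
the trajectories in `𝒩`. -/
theorem IsReversedGirsanov.exists_measurable_version {d : ℕ} {𝒩 : Finset (Site d)}
    {b₀ : ℝ≥0 → PathSpace d → ℝ} (hb : IsAdmissibleDrift 𝒩 b₀) {μ : Measure (PathSpace d)}
    {t : ℝ≥0} {F : PathSpace d → ℝ} (hF : IsReversedGirsanov μ b₀ t F) :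
    ∃ G : PathSpace d → ℝ, Measurable G ∧ DependsOn G (𝒩 : Set (Site d)) ∧
      (fun ω => F (timeReversal t ω)) =ᵐ[μ] G := by
  obtain ⟨-, I, ⟨⟨π, hπ⟩, hI⟩, hFI⟩ := hF
  obtain ⟨ns, -, hns⟩ := (hI π hπ).exists_seq_tendsto_ae
  have hpath : ∀ ω ω' : PathSpace d, (∀ j ∈ (𝒩 : Set (Site d)), ω j = ω' j) →
      ∀ j ∈ 𝒩, ∀ s, timeReversal t ω j s = timeReversal t ω' j s := by
    intro ω ω' h j hj s
    simp [timeReversal, h j hj]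
  have hdrift : ∀ ω ω' : PathSpace d, (∀ j ∈ (𝒩 : Set (Site d)), ω j = ω' j) →
      ∀ s, b₀ s (timeReversal t ω) = b₀ s (timeReversal t ω') := fun ω ω' h s =>
    hb.adapted s _ _ fun j hj u _ => hpath ω ω' h j hj u
  have hb_meas (s : ℝ≥0) : Measurable fun ω : PathSpace d => b₀ s (timeReversal t ω) :=
    hb.measurable.comp (measurable_const.prodMk (measurable_timeReversal t))
  let S : ℕ → PathSpace d → ℝ := fun k => (π (ns k)).leftSum
    (fun s ω => b₀ s (timeReversal t ω)) (fun s ω => timeReversal t ω 0 s)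
  have hS_meas (k : ℕ) : Measurable (S k) := by
    refine Finset.measurable_fun_sum _ fun j _ => (hb_meas _).mul ?_
    exact (measurable_path_eval _ _).sub (measurable_path_eval _ _)
  have hS_dep (k : ℕ) : DependsOn (S k) (𝒩 : Set (Site d)) := by
    intro ω ω' h
    refine Finset.sum_congr rfl fun j _ => ?_
    simp only [hdrift ω ω' h, hpath ω ω' h 0 hb.origin_mem]
  -- Along a subsequence the left-point sums converge almost surely. Their `limsup` is defined
  -- everywhere, so it inherits measurability and locality from the sums, and it equals the
  -- stochastic integral where they converge.
  refine ⟨fun ω => limsup (fun k => S k ω) atTop -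
    1 / 2 * ∫ s in (0 : ℝ)..t, b₀ s.toNNReal (timeReversal t ω) ^ 2, ?_, ?_, ?_⟩
  · refine (Measurable.limsup hS_meas).sub (Measurable.const_mul ?_ _)
    simp_rw [intervalIntegral.integral_of_le t.coe_nonneg]
    refine (StronglyMeasurable.integral_prod_left (f := fun s ω =>
      b₀ (Real.toNNReal s) (timeReversal t ω) ^ 2) ?_).measurable
    refine Measurable.stronglyMeasurable (Measurable.pow_const ?_ 2)
    exact hb.measurable.comp ((measurable_real_toNNReal.comp measurable_fst).prodMk
      ((measurable_timeReversal t).comp measurable_snd))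
  · intro ω ω' h
    simp only [hdrift ω ω' h, hS_dep _ h]
  · filter_upwards [hFI, hns] with ω h1 h2
    rw [h1, Tendsto.limsup_eq h2]

end Drift

/-! ### Counting sets through a site, and bounds on the interaction uniform in the set. -/

section Interaction

variable {d : ℕ}

theorem translate_neg_eq (i : Site d) (A : Finset (Site d)) :
    translate (-i) A = A.image fun j => j - i := by
  simp [translate, sub_eq_add_neg]

theorem translate_injective (i : Site d) :
    Function.Injective (translate i : Finset (Site d) → Finset (Site d)) :=
  Finset.image_injective (add_left_injective i)

/-- The subsets of the cube of side `2⌈r⌉` centred at the origin. -/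
def subsetsOfCube (d : ℕ) (r : ℝ) : Finset (Finset (Site d)) :=
  (Finset.Icc (fun _ => -⌈r⌉) (fun _ => ⌈r⌉) : Finset (Site d)).powerset

theorem translate_neg_mem_subsetsOfCube {r : ℝ} {A : Finset (Site d)} {i : Site d} (hi : i ∈ A)
    (hr : Metric.diam (A : Set (Site d)) ≤ r) : translate (-i) A ∈ subsetsOfCube d r := by
  rw [subsetsOfCube, Finset.mem_powerset, translate_neg_eq]
  intro k hk
  obtain ⟨j, hj, rfl⟩ := Finset.mem_image.1 hk
  have hdist : dist j i ≤ r :=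
    (Metric.dist_le_diam_of_mem A.finite_toSet.isBounded hj hi).trans hr
  have hcoord (a : Fin d) : |j a - i a| ≤ ⌈r⌉ := by
    have h1 : ((|j a - i a| : ℤ) : ℝ) ≤ ⌈r⌉ := by
      have h2 := (dist_le_pi_dist j i a).trans (hdist.trans (Int.le_ceil r))
      rw [Int.dist_eq] at h2
      exact_mod_cast h2
    exact_mod_cast h1
  rw [Finset.mem_Icc]
  exact ⟨fun a => (abs_le.1 (hcoord a)).1, fun a => (abs_le.1 (hcoord a)).2⟩

theorem card_filter_mem_le_of_diam_le {r : ℝ} (S : Finset (Finset (Site d))) (i : Site d)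
    (hS : ∀ A ∈ S, i ∈ A → Metric.diam (A : Set (Site d)) ≤ r) :
    (S.filter (i ∈ ·)).card ≤ (subsetsOfCube d r).card := by
  refine Finset.card_le_card_of_injOn (translate (-i)) (fun A hA => ?_)
    (translate_injective (-i)).injOn
  rw [Finset.mem_coe, Finset.mem_filter] at hA
  exact translate_neg_mem_subsetsOfCube hA.2 (hS A hA.1 hA.2)

/-- A translate of `𝒩` containing `i` is determined by the point of `𝒩` that is moved to `i`. -/
theorem card_filter_mem_le_of_translates (𝒩 : Finset (Site d)) (S : Finset (Finset (Site d)))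
    (i : Site d) (hS : ∀ A ∈ S, ∃ k, A = translate k 𝒩) :
    (S.filter (i ∈ ·)).card ≤ 𝒩.card := by
  refine (Finset.card_le_card fun A hA => ?_).trans
    (Finset.card_image_le (s := 𝒩) (f := fun j => translate (i - j) 𝒩))
  obtain ⟨hA, hi⟩ := Finset.mem_filter.1 hA
  obtain ⟨k, rfl⟩ := hS A hA
  obtain ⟨j, hj, rfl⟩ := Finset.mem_image.1 hi
  exact Finset.mem_image.2 ⟨j, hj, by simp⟩

variable {φ : Finset (Site d) → Config d → ℝ}

theorem IsInteraction.eq_translate_neg (hφ : IsInteraction φ) (A : Finset (Site d)) (i : Site d)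
    (x : Config d) : φ A x = φ (translate (-i) A) fun j => x (j + i) := by
  simpa using (hφ.translation_invariant A (-i) x).symm

/-- By translation invariance the set may be assumed to contain the origin, and then the bound is
one term of the summability series there. -/
theorem IsInteraction.exists_uniform_bound (hφ : IsInteraction φ) :
    ∃ B : ℝ, 0 ≤ B ∧ ∀ A : Finset (Site d), A.Nonempty → ∀ x, |φ A x| ≤ B := by
  refine ⟨(∑' A : {A : Finset (Site d) // 0 ∈ A}, ⨆ x, ‖φ A x‖ₑ).toReal,
    ENNReal.toReal_nonneg, fun A ⟨i, hi⟩ x => ?_⟩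
  rw [hφ.eq_translate_neg A i x]
  have h0 : (0 : Site d) ∈ translate (-i) A := by
    rw [translate_neg_eq]
    exact Finset.mem_image.2 ⟨i, hi, sub_self i⟩
  have hle : ‖φ (translate (-i) A) fun j => x (j + i)‖ₑ ≤
      ∑' A : {A : Finset (Site d) // 0 ∈ A}, ⨆ x, ‖φ A x‖ₑ :=
    (le_iSup (fun y => ‖φ (translate (-i) A) y‖ₑ) _).trans
      (ENNReal.le_tsum (f := fun A : {A : Finset (Site d) // 0 ∈ A} => ⨆ x, ‖φ A x‖ₑ)
        ⟨translate (-i) A, h0⟩)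
  have := ENNReal.toReal_mono (hφ.summable 0) hle
  rwa [toReal_enorm] at this

theorem sq_dist_restrict_le (A : Finset (Site d)) (x y : Config d) :
    dist (A.restrict x) (A.restrict y) ^ 2 ≤ ∑ j ∈ A, (x j - y j) ^ 2 := by
  have h0 : 0 ≤ ∑ j ∈ A, (x j - y j) ^ 2 := Finset.sum_nonneg fun _ _ => sq_nonneg _
  have : dist (A.restrict x) (A.restrict y) ≤ √(∑ j ∈ A, (x j - y j) ^ 2) := by
    refine (dist_pi_le_iff (Real.sqrt_nonneg _)).2 fun j => ?_
    rw [Real.dist_eq]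
    exact Real.abs_le_sqrt
      (Finset.single_le_sum (f := fun j => (x j - y j) ^ 2) (fun _ _ => sq_nonneg _) j.2)
  calc _ ≤ √(∑ j ∈ A, (x j - y j) ^ 2) ^ 2 := by gcongr
    _ = _ := Real.sq_sqrt h0

/-- Up to translation only finitely many sets have diameter at most `r`, so the sum of their squared
Lipschitz constants serves for all sets. -/
theorem IsInteraction.exists_uniform_lipschitz (hφ : IsInteraction φ) (hr : HasFiniteRange φ)
    (hL : IsLipschitzInteraction φ) :
    ∃ C : ℝ, 0 ≤ C ∧ ∀ A : Finset (Site d), A.Nonempty → ∀ x y,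
      (φ A x - φ A y) ^ 2 ≤ C * ∑ j ∈ A, (x j - y j) ^ 2 := by
  obtain ⟨r, -, hr⟩ := hr
  choose c hc using hL
  have hC : 0 ≤ ∑ A ∈ subsetsOfCube d r, c A ^ 2 := Finset.sum_nonneg fun _ _ => sq_nonneg _
  refine ⟨∑ A ∈ subsetsOfCube d r, c A ^ 2, hC, fun A ⟨i, hi⟩ x y => ?_⟩
  have hsum : 0 ≤ ∑ j ∈ A, (x j - y j) ^ 2 := Finset.sum_nonneg fun _ _ => sq_nonneg _
  rcases lt_or_ge r (Metric.diam (A : Set (Site d))) with hd | hd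
  · simpa [hr A hd] using mul_nonneg hC hsum
  set A' := translate (-i) A with hA'
  have hreindex : ∑ j ∈ A', (x (j + i) - y (j + i)) ^ 2 = ∑ j ∈ A, (x j - y j) ^ 2 := by
    rw [hA', translate, Finset.sum_image fun a _ b _ h => add_right_cancel h]
    simp
  rw [hφ.eq_translate_neg A i x, hφ.eq_translate_neg A i y, ← hA', ← hreindex, ← sq_abs]
  calc _ ≤ (c A' * dist (A'.restrict fun j => x (j + i)) (A'.restrict fun j => y (j + i))) ^ 2 := by
        gcongr
        exact hc A' _ _
    _ = c A' ^ 2 * dist (A'.restrict fun j => x (j + i)) (A'.restrict fun j => y (j + i)) ^ 2 :=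
        mul_pow _ _ _
    _ ≤ _ := by
        refine mul_le_mul ?_ (sq_dist_restrict_le A' _ _) (sq_nonneg _) hC
        exact Finset.single_le_sum (f := fun A => c A ^ 2) (fun _ _ => sq_nonneg _)
          (translate_neg_mem_subsetsOfCube hi hd)

theorem IsInteraction.measurable (hφ : IsInteraction φ) (A : Finset (Site d)) :
    Measurable (φ A) :=
  (hφ.local_measurable A).mono cylinderEvents_le_pi le_rfl

theorem IsLipschitzInteraction.dependsOn (hL : IsLipschitzInteraction φ) (A : Finset (Site d)) :
    DependsOn (φ A) (A : Set (Site d)) := by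
  intro x y hxy
  obtain ⟨C, hC⟩ := hL A
  have hres : A.restrict x = A.restrict y := funext fun j => hxy j j.2
  have := hC x y
  rw [hres, dist_self, mul_zero] at this
  exact sub_eq_zero.1 (abs_eq_zero.1 (le_antisymm this (abs_nonneg _)))

end Interaction

/-! ### Elementary estimates for the exponential. -/

section Elementary

theorem abs_exp_sub_one_le_exp_abs_sub_one (g : ℝ) : |Real.exp g - 1| ≤ Real.exp |g| - 1 := by
  rcases le_total 0 g with hg | hg
  · rw [abs_of_nonneg hg, abs_of_nonneg (sub_nonneg.2 (Real.one_le_exp hg))]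
  · rw [abs_of_nonpos hg, abs_of_nonpos (sub_nonpos.2 (Real.exp_le_one_iff.2 hg))]
    have h1 := Real.add_one_le_exp (g)
    have h2 : Real.exp g * Real.exp (-g) = 1 := by rw [← Real.exp_add]; simp
    -- The claim is `2 ≤ exp g + exp (-g)`, for two positive numbers with product `1`.
    nlinarith [Real.exp_pos g, Real.exp_pos (-g), sq_nonneg (Real.exp g - 1),
      sq_nonneg (Real.exp (-g) - 1)]

theorem abs_exp_sub_one_le_mul_exp (v : ℝ) : |Real.exp v - 1| ≤ Real.exp |v| * |v| := by
  refine (abs_exp_sub_one_le_exp_abs_sub_one v).trans ?_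
  have h1 := Real.add_one_le_exp (-|v|)
  have h2 : Real.exp |v| * Real.exp (-|v|) = 1 := by rw [← Real.exp_add]; simp
  nlinarith [Real.exp_pos |v|]

/-- If `u` is bounded, all moments of `exp (g - u) - 1` are controlled by those of `exp |g| - 1`
and the second moment of `u`. -/
theorem exp_sub_one_pow_le {b : ℝ} {n : ℕ} (hn : n ≠ 0) {g u : ℝ} (hu : |u| ≤ b) :
    (Real.exp (g - u) - 1) ^ (2 * n) ≤ (2 * Real.exp b) ^ (2 * n) * (1 + b ^ (2 * n - 2)) *
      ((Real.exp |g| - 1) ^ (2 * n) + u ^ 2) := by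
  set a := Real.exp |g| - 1 with ha
  have ha0 : 0 ≤ a := sub_nonneg.2 (Real.one_le_exp (abs_nonneg g))
  have hb : 0 ≤ b := (abs_nonneg u).trans hu
  have h1 : |Real.exp (g - u) - 1| ≤ Real.exp b * (a + |u|) := by
    have hsplit : Real.exp (g - u) - 1 =
        Real.exp (-u) * (Real.exp g - 1) + (Real.exp (-u) - 1) := by
      rw [sub_eq_add_neg g u, Real.exp_add]
      ring
    have hexp : Real.exp (-u) ≤ Real.exp b := Real.exp_le_exp.2 ((neg_le_abs u).trans hu)
    have h2 : |Real.exp (-u) - 1| ≤ Real.exp b * |u| := by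
      refine (abs_exp_sub_one_le_mul_exp (-u)).trans ?_
      rw [abs_neg]
      gcongr
    calc _ ≤ |Real.exp (-u) * (Real.exp g - 1)| + |Real.exp (-u) - 1| := hsplit ▸ abs_add_le _ _
      _ ≤ Real.exp b * a + Real.exp b * |u| := by
        rw [abs_mul, abs_of_pos (Real.exp_pos _)]
        gcongr
        exact abs_exp_sub_one_le_exp_abs_sub_one g
      _ = _ := by ring
  -- All powers of `u` but two are absorbed by its bound, so that a second moment suffices.
  have hupow : |u| ^ (2 * n) ≤ b ^ (2 * n - 2) * u ^ 2 := by
    rw [← sq_abs u]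
    calc |u| ^ (2 * n) = |u| ^ (2 * n - 2) * |u| ^ 2 := by rw [← pow_add]; congr 1; omega
      _ ≤ _ := by gcongr
  have hadd : (a + |u|) ^ (2 * n) ≤ 2 ^ (2 * n) * (a ^ (2 * n) + |u| ^ (2 * n)) := by
    refine (add_pow_le ha0 (abs_nonneg u) (2 * n)).trans ?_
    gcongr
    · norm_num
    · omega
  have hbp : 0 ≤ b ^ (2 * n - 2) := pow_nonneg hb _
  have hap : 0 ≤ a ^ (2 * n) := pow_nonneg ha0 _
  calc (Real.exp (g - u) - 1) ^ (2 * n) = |Real.exp (g - u) - 1| ^ (2 * n) :=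
        (Even.pow_abs (even_two_mul n) _).symm
    _ ≤ (Real.exp b * (a + |u|)) ^ (2 * n) := by gcongr
    _ = Real.exp b ^ (2 * n) * (a + |u|) ^ (2 * n) := mul_pow _ _ _
    _ ≤ Real.exp b ^ (2 * n) * (2 ^ (2 * n) * (a ^ (2 * n) + b ^ (2 * n - 2) * u ^ 2)) := by
        gcongr
        exact hadd.trans (by gcongr)
    _ = (2 * Real.exp b) ^ (2 * n) * (a ^ (2 * n) + b ^ (2 * n - 2) * u ^ 2) := by
        rw [mul_pow]
        ring
    _ ≤ (2 * Real.exp b) ^ (2 * n) *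
          ((1 + b ^ (2 * n - 2)) * (a ^ (2 * n) + u ^ 2)) := by
        gcongr
        nlinarith [sq_nonneg u, mul_nonneg hbp hap]
    _ = _ := by ring

end Elementary

/-! ### Versions and moments of single factors. -/

section ClusterFactors

variable {d : ℕ} {W : Measure C(ℝ≥0, ℝ)} {𝒩 : Finset (Site d)}
  {F : ℝ≥0 → PathSpace d → ℝ} {φ : Finset (Site d) → Config d → ℝ}

/-- The supremum over the initial conditions of the moment in `ExponentialMomentCondition`. -/
def girsanovMoment (W : Measure C(ℝ≥0, ℝ)) (F : ℝ≥0 → PathSpace d → ℝ) (p : ℕ) (t : ℝ≥0) :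
    ℝ≥0∞ :=
  ⨆ x : Config d, ∫⁻ ω,
    ENNReal.ofReal ((Real.exp |F t (timeReversal t ω)| - 1) ^ (2 * p)) ∂(wienerFrom W x)

/-- The constant in the moment estimate for the factors of a cluster functional. -/
def factorConst (B : ℝ) (n : ℕ) : ℝ :=
  (2 * Real.exp (2 * B)) ^ (2 * n) * (1 + (2 * B) ^ (2 * n - 2))

theorem girsanovPotential_of_not_translate {A : Finset (Site d)}
    (hA : ¬ ∃ k, A = translate k 𝒩) (t : ℝ≥0) (ω : PathSpace d) :
    girsanovPotential 𝒩 F t A ω = 0 :=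
  dif_neg hA

/-- Shifting the paths only shifts the initial configuration, so the result at the origin applies;
the supremum over configurations in `girsanovMoment` makes the bound independent of the translation.
-/
theorem exists_girsanovPotential_version_of_translate [IsProbabilityMeasure W]
    {b₀ : ℝ≥0 → PathSpace d → ℝ} (hb : IsAdmissibleDrift 𝒩 b₀) {t : ℝ≥0}
    (hF : ∀ x, IsReversedGirsanov (wienerFrom W x) b₀ t (F t)) (p : ℕ) {A : Finset (Site d)}
    (hA : ∃ k, A = translate k 𝒩) (x : Config d) :
    ∃ g : PathSpace d → ℝ, Measurable g ∧ DependsOn g (A : Set (Site d)) ∧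
      (girsanovPotential 𝒩 F t A =ᵐ[wienerFrom W x] fun ω => -g ω) ∧
      ∫⁻ ω, ENNReal.ofReal ((Real.exp |g ω| - 1) ^ (2 * p)) ∂wienerFrom W x ≤
        girsanovMoment W F p t := by
  set k := hA.choose with hk
  have hAk : A = translate k 𝒩 := hA.choose_spec
  obtain ⟨G, hGm, hGd, hGF⟩ := (hF fun j => x (j + k)).exists_measurable_version hb
  refine ⟨G ∘ shiftPath k, hGm.comp (measurable_shiftPath k), fun ω ω' h => ?_, ?_, ?_⟩
  · refine hGd fun j hj => h (j + k) ?_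
    rw [hAk]
    exact Finset.mem_coe.2 (Finset.mem_image_of_mem _ hj)
  · rw [← wienerFrom_map_shiftPath] at hGF
    filter_upwards [ae_of_ae_map (measurable_shiftPath k).aemeasurable hGF] with ω hω
    rw [girsanovPotential, dif_pos hA, ← hk, hω, Function.comp_apply]
  · have hmeas : Measurable fun ω => ENNReal.ofReal ((Real.exp |G ω| - 1) ^ (2 * p)) := by
      fun_prop
    rw [show (fun ω => ENNReal.ofReal ((Real.exp |(G ∘ shiftPath k) ω| - 1) ^ (2 * p))) =
      fun ω => (fun ω => ENNReal.ofReal ((Real.exp |G ω| - 1) ^ (2 * p))) (shiftPath k ω) from rfl,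
      ← lintegral_map hmeas (measurable_shiftPath k), wienerFrom_map_shiftPath]
    refine le_trans (le_of_eq (lintegral_congr_ae ?_))
      (le_iSup (fun x : Config d => ∫⁻ ω,
        ENNReal.ofReal ((Real.exp |F t (timeReversal t ω)| - 1) ^ (2 * p)) ∂(wienerFrom W x))
        fun j => x (j + k))
    filter_upwards [hGF] with ω hω
    rw [hω]

/-- Every factor of a cluster functional has a version that is a measurable function of the
trajectories in the corresponding set, and whose moment of order `2n` is small. If the set is a
translate of `𝒩` this holds for `n = p` only. -/
theorem exists_factor_version (hW : IsWienerMeasure W) (hφ : IsInteraction φ)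
    (hL : IsLipschitzInteraction φ) {B C : ℝ} {N : ℕ} (hC : 0 ≤ C)
    {b₀ : ℝ≥0 → PathSpace d → ℝ} (hb : IsAdmissibleDrift 𝒩 b₀) {t : ℝ≥0}
    (hF : ∀ x, IsReversedGirsanov (wienerFrom W x) b₀ t (F t)) {p n : ℕ} {A : Finset (Site d)}
    (hφB : ∀ x, |φ A x| ≤ B) (hφC : ∀ x y, (φ A x - φ A y) ^ 2 ≤ C * ∑ j ∈ A, (x j - y j) ^ 2)
    (hAN : A.card ≤ N) (hn : n ≠ 0) (hnp : (∃ k, A = translate k 𝒩) → n = p) (x : Config d) :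
    ∃ h : PathSpace d → ℝ, Measurable h ∧ DependsOn h (A : Set (Site d)) ∧
      ((fun ω => Real.exp (-pathPotential 𝒩 F φ t A ω) - 1) =ᵐ[wienerFrom W x] h) ∧
      ∫⁻ ω, ENNReal.ofReal (h ω ^ (2 * n)) ∂wienerFrom W x ≤
        ENNReal.ofReal (factorConst B n) *
          (girsanovMoment W F p t + ENNReal.ofReal C * (N * t)) := by
  have := hW.isProbabilityMeasure
  obtain ⟨g, hgm, hgd, hgF, hgint⟩ : ∃ g : PathSpace d → ℝ, Measurable g ∧
      DependsOn g (A : Set (Site d)) ∧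
      (girsanovPotential 𝒩 F t A =ᵐ[wienerFrom W x] fun ω => -g ω) ∧
      ∫⁻ ω, ENNReal.ofReal ((Real.exp |g ω| - 1) ^ (2 * n)) ∂wienerFrom W x ≤
        girsanovMoment W F p t := by
    by_cases hA : ∃ k, A = translate k 𝒩
    · rw [hnp hA]
      exact exists_girsanovPotential_version_of_translate hb hF p hA x
    -- Without a Girsanov term the moment is `0` at every order, which leaves `n` free.
    · refine ⟨fun _ => 0, measurable_const, fun _ _ _ => rfl, ?_, ?_⟩
      · exact Eventually.of_forall fun ω => by
          simp [girsanovPotential_of_not_translate hA]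
      · simp [hn]
  have hspin (s : ℝ≥0) : Measurable fun ω : PathSpace d => φ A fun i => ω i s :=
    (hφ.measurable A).comp (measurable_pi_lambda _ fun i => measurable_path_eval i s)
  let u : PathSpace d → ℝ := fun ω => φ A (fun i => ω i t) - φ A (fun i => ω i 0)
  have hum : Measurable u := (hspin t).sub (hspin 0)
  have hud : DependsOn u (A : Set (Site d)) := by
    intro ω ω' h
    have hs (s : ℝ≥0) : φ A (fun i => ω i s) = φ A fun i => ω' i s :=
      hL.dependsOn A fun i hi => by rw [h i hi]
    simp only [u, hs]
  have huB (ω : PathSpace d) : |u ω| ≤ 2 * B := by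
    refine (abs_sub _ _).trans ?_
    linarith [hφB fun i => ω i t, hφB fun i => ω i 0]
  have hu_int : ∫⁻ ω, ENNReal.ofReal (u ω ^ 2) ∂wienerFrom W x ≤ ENNReal.ofReal C * (N * t) := by
    have hterm (j : Site d) :
        Measurable fun ω : PathSpace d => ENNReal.ofReal ((ω j t - ω j 0) ^ 2) :=
      (((measurable_path_eval j t).sub (measurable_path_eval j 0)).pow_const 2).ennreal_ofReal
    calc _ ≤ ∫⁻ ω, ENNReal.ofReal C * ∑ j ∈ A, ENNReal.ofReal ((ω j t - ω j 0) ^ 2)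
            ∂wienerFrom W x := by
          refine lintegral_mono fun ω => ?_
          rw [← ENNReal.ofReal_sum_of_nonneg fun j _ => sq_nonneg _, ← ENNReal.ofReal_mul hC]
          exact ENNReal.ofReal_le_ofReal (hφC _ _)
      _ = ENNReal.ofReal C * (A.card * t) := by
          rw [lintegral_const_mul _ (Finset.measurable_fun_sum _ fun j _ => hterm j),
            lintegral_finsetSum _ fun j _ => hterm j]
          simp [lintegral_increment_sq hW x]
      _ ≤ _ := by gcongr
  refine ⟨fun ω => Real.exp (g ω - u ω) - 1, by fun_prop, fun ω ω' h => ?_, ?_, ?_⟩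
  · simp only [hgd h, hud h]
  · filter_upwards [hgF] with ω hω
    rw [pathPotential, hω]
    simp only [u]
    ring_nf
  · have hgm' : Measurable fun ω => ENNReal.ofReal ((Real.exp |g ω| - 1) ^ (2 * n)) := by
      fun_prop
    have hK : 0 ≤ factorConst B n := by
      have hB : 0 ≤ 2 * B := (abs_nonneg _).trans (huB fun _ => 0)
      unfold factorConst
      positivity
    calc _ ≤ ∫⁻ ω, ENNReal.ofReal (factorConst B n) *
            (ENNReal.ofReal ((Real.exp |g ω| - 1) ^ (2 * n)) + ENNReal.ofReal (u ω ^ 2))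
              ∂wienerFrom W x := by
          refine lintegral_mono fun ω => ?_
          rw [← ENNReal.ofReal_add ((even_two_mul n).pow_nonneg _) (sq_nonneg _),
            ← ENNReal.ofReal_mul hK]
          exact ENNReal.ofReal_le_ofReal (exp_sub_one_pow_le hn (huB ω))
      _ ≤ _ := by
          rw [lintegral_const_mul' _ _ ENNReal.ofReal_ne_top, lintegral_add_left hgm']
          gcongr

end ClusterFactors

/-! ### Choice of exponents and the bound for a whole cluster. -/

section ClusterBound

theorem exists_pos_tendsto_zero_of_rpow {δ : ℝ≥0 → ℝ≥0∞} (hδ : Tendsto δ (𝓝[>] 0) (𝓝 0))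
    {κ : ℝ} (hκ : 0 < κ) :
    ∃ lam : ℝ≥0 → ℝ, (∀ t, 0 < lam t) ∧ Tendsto lam (𝓝[>] 0) (𝓝 0) ∧
      ∃ t₀ : ℝ≥0, 0 < t₀ ∧ ∀ t : ℝ≥0, 0 < t → t ≤ t₀ →
        δ t ≤ 1 ∧ δ t ^ κ ≤ ENNReal.ofReal (lam t) := by
  -- The summand `t` ensures strict positivity for `t > 0` even where `δ t` vanishes; the value at
  -- `t = 0` is arbitrary.
  refine ⟨fun t => if t = 0 then 1 else (δ t ^ κ).toReal + t, fun t => ?_, ?_, ?_⟩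
  · rcases eq_or_ne t 0 with ht | ht
    · simp [ht]
    · have : (0 : ℝ) < t := NNReal.coe_pos.2 (pos_iff_ne_zero.2 ht)
      simp only [ht, if_false]
      positivity
  · have h1 : Tendsto (fun t : ℝ≥0 => (δ t ^ κ).toReal + t) (𝓝[>] 0) (𝓝 0) := by
      have h2 : Tendsto (fun t => (δ t ^ κ).toReal) (𝓝[>] 0) (𝓝 0) := by
        have h3 := hδ.ennrpow_const κ
        rw [ENNReal.zero_rpow_of_pos hκ] at h3
        exact (ENNReal.tendsto_toReal ENNReal.zero_ne_top).comp h3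
      have h4 : Tendsto (fun t : ℝ≥0 => (t : ℝ)) (𝓝[>] 0) (𝓝 0) :=
        (NNReal.continuous_coe.tendsto 0).mono_left nhdsWithin_le_nhds
      simpa using h2.add h4
    refine h1.congr' ?_
    filter_upwards [self_mem_nhdsWithin] with t ht
    simp [(show (0 : ℝ≥0) < t from ht).ne']
  · have hev : ∀ᶠ t in 𝓝[>] (0 : ℝ≥0), δ t ≤ 1 := hδ.eventually_le_const zero_lt_one
    obtain ⟨t₀, ht₀, hsub⟩ := mem_nhdsGT_iff_exists_Ioc_subset.1 hev
    refine ⟨t₀, ht₀, fun t ht htt => ?_⟩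
    have h1 : δ t ≤ 1 := hsub ⟨ht, htt⟩
    refine ⟨h1, ?_⟩
    have h2 : δ t ^ κ ≠ ∞ := ENNReal.rpow_ne_top_of_nonneg hκ.le (h1.trans_lt ENNReal.one_lt_top).ne
    simp only [ht.ne', if_false]
    rw [ENNReal.ofReal_add ENNReal.toReal_nonneg t.coe_nonneg, ENNReal.ofReal_toReal h2]
    exact le_self_add

/-- If `|𝒩| < p ≤ M` and `M` bounds the number of subsets of the cube, then at every site the
exponents `1 / (2p)` for the translates of `𝒩` and `1 / (2M)` for the other sets add up to at
most `1`. -/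
theorem sum_exponents_le_one {d : ℕ} {𝒩 : Finset (Site d)} {p M : ℕ} {r : ℝ} (hp : 𝒩.card < p)
    (hM : 0 < M) (hrM : (subsetsOfCube d r).card ≤ M) (P : Finset (Site d) → Prop)
    [DecidablePred P] (hP : ∀ A, P A ↔ ∃ k, A = translate k 𝒩) (S : Finset (Finset (Site d)))
    (hS : ∀ A ∈ S, ¬ P A → Metric.diam (A : Set (Site d)) ≤ r) (i : Site d) :
    ∑ A ∈ S with i ∈ A, ((2 * (if P A then p else M) : ℕ) : ℝ)⁻¹ ≤ 1 := by
  have hp' : (0 : ℝ) < p := by exact_mod_cast (Nat.zero_le _).trans_lt hp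
  have hM' : (0 : ℝ) < M := by exact_mod_cast hM
  have hbound (n c : ℕ) (T : Finset (Finset (Site d))) (hn : (0 : ℝ) < n) (hc : T.card ≤ c)
      (hcn : c ≤ n) : ∑ A ∈ T, ((2 * n : ℕ) : ℝ)⁻¹ ≤ 1 / 2 := by
    have : (T.card : ℝ) ≤ n := by exact_mod_cast hc.trans hcn
    rw [Finset.sum_const, nsmul_eq_mul, Nat.cast_mul, Nat.cast_two, ← div_eq_mul_inv,
      div_le_div_iff₀ (by positivity) (by norm_num)]
    linarith
  rw [← Finset.sum_filter_add_sum_filter_not _ P]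
  have h1 : ∑ A ∈ (S.filter (i ∈ ·)).filter P, ((2 * (if P A then p else M) : ℕ) : ℝ)⁻¹ ≤ 1 / 2 := by
    rw [Finset.sum_congr rfl fun A hA => by rw [if_pos (Finset.mem_filter.1 hA).2]]
    refine hbound p _ _ hp' ?_ hp.le
    rw [Finset.filter_comm]
    exact card_filter_mem_le_of_translates 𝒩 _ i fun A hA =>
      (hP A).1 (Finset.mem_filter.1 hA).2
  have h2 : ∑ A ∈ (S.filter (i ∈ ·)).filter (¬ P ·), ((2 * (if P A then p else M) : ℕ) : ℝ)⁻¹ ≤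
      1 / 2 := by
    rw [Finset.sum_congr rfl fun A hA => by rw [if_neg (Finset.mem_filter.1 hA).2]]
    refine hbound M _ _ hM' ?_ hrM
    rw [Finset.filter_comm]
    refine card_filter_mem_le_of_diam_le (r := r) _ i fun A hA _ => ?_
    exact hS A (Finset.mem_filter.1 hA).1 (Finset.mem_filter.1 hA).2
  linarith

theorem card_clusterSupport_le {d N : ℕ} {γ : Finset (Finset (Site d))} (hγ : IsCluster N γ) :
    (clusterSupport γ).card ≤ γ.card * N :=
  Finset.card_biUnion_le_card_mul _ _ _ hγ.card_le

/-- The product of functions, one for each set in a cluster, with small moments: the integral of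
its absolute value is at most `(δ ^ (1 / (2MN))) ^ |γ|`. -/
theorem lintegral_enorm_prod_le {d N M : ℕ} {W : Measure C(ℝ≥0, ℝ)} [IsProbabilityMeasure W]
    (x : Config d) {γ : Finset (Finset (Site d))} (hγ : IsCluster N γ) (hN : 0 < N)
    {h : Finset (Site d) → PathSpace d → ℝ} {n : Finset (Site d) → ℕ}
    (hh : ∀ A ∈ γ, Measurable (h A)) (hd : ∀ A ∈ γ, DependsOn (h A) (A : Set (Site d)))
    (hn0 : ∀ A ∈ γ, n A ≠ 0) (hnM : ∀ A ∈ γ, n A ≤ M)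
    (hsum : ∀ i, ∑ A ∈ γ with i ∈ A, ((2 * n A : ℕ) : ℝ)⁻¹ ≤ 1)
    {δ : ℝ≥0∞} (hδ : δ ≤ 1)
    (hint : ∀ A ∈ γ, ∫⁻ ω, ENNReal.ofReal (h A ω ^ (2 * n A)) ∂wienerFrom W x ≤ δ) :
    ∫⁻ ω, ‖∏ A ∈ γ, h A ω‖ₑ ∂wienerFrom W x ≤
      (δ ^ ((2 * M * N : ℝ)⁻¹)) ^ (clusterSupport γ).card := by
  have hprob (i : Site d) := isProbabilityMeasure_trajectory_map (W := W) (x i)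
  have hM : 0 < M := by
    obtain ⟨A, hA⟩ := hγ.nonempty
    exact (Nat.pos_of_ne_zero (hn0 A hA)).trans_le (hnM A hA)
  let f : Finset (Site d) → PathSpace d → ℝ≥0∞ := fun A ω => ENNReal.ofReal (h A ω ^ (2 * n A))
  have hf : ∀ A ∈ γ, Measurable (f A) := fun A hA => ((hh A hA).pow_const _).ennreal_ofReal
  have hfd : ∀ A ∈ γ, DependsOn (f A) (A : Set (Site d)) := fun A hA ω ω' hω => by
    simp only [f, hd A hA hω]
  -- The exponents `2 * n A` are even, so `h A ^ (2 * n A)` is a power of `|h A|` and taking the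
  -- root recovers `|h A|`.
  have hnorm (ω : PathSpace d) :
      ‖∏ A ∈ γ, h A ω‖ₑ = ∏ A ∈ γ, f A ω ^ ((2 * n A : ℕ) : ℝ)⁻¹ := by
    rw [← ofReal_norm, norm_prod, ENNReal.ofReal_prod_of_nonneg fun A _ => norm_nonneg _]
    refine Finset.prod_congr rfl fun A hA => ?_
    have h2 : 2 * n A ≠ 0 := mul_ne_zero two_ne_zero (hn0 A hA)
    rw [show f A ω = ENNReal.ofReal ‖h A ω‖ ^ (2 * n A) by
      rw [← ENNReal.ofReal_pow (norm_nonneg _), Real.norm_eq_abs, (even_two_mul _).pow_abs],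
      ENNReal.pow_rpow_inv_natCast h2]
  simp_rw [hnorm]
  set ε : ℝ≥0∞ := δ ^ ((2 * M * N : ℝ)⁻¹) with hε
  have hε1 : ε ≤ 1 := ENNReal.rpow_le_one hδ (by positivity)
  calc _ ≤ ∏ A ∈ γ, (∫⁻ ω, f A ω ∂wienerFrom W x) ^ ((2 * n A : ℕ) : ℝ)⁻¹ :=
        lintegral_infinitePi_prod_rpow_le _ γ (D := fun A => A) hf hfd
          (fun A _ => by positivity) hsum
    _ ≤ ∏ A ∈ γ, ε ^ N := by
        refine Finset.prod_le_prod' fun A hA => ?_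
        -- As `δ ≤ 1`, lowering the exponent from `1 / (2 n A)` to `1 / (2M)` only increases the
        -- power. The spare `N` in `ε` pays for the sites of `A`.
        have hexp : ((2 * M * N : ℝ)⁻¹) * N ≤ ((2 * n A : ℕ) : ℝ)⁻¹ := by
          have hN' : (0 : ℝ) < N := by exact_mod_cast hN
          have hnA : (0 : ℝ) < n A := by exact_mod_cast Nat.pos_of_ne_zero (hn0 A hA)
          have hle : (n A : ℝ) ≤ M := by exact_mod_cast hnM A hA
          rw [mul_inv, mul_assoc, inv_mul_cancel₀ hN'.ne', mul_one, Nat.cast_mul, Nat.cast_two]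
          gcongr
        calc _ ≤ δ ^ ((2 * n A : ℕ) : ℝ)⁻¹ := by
              gcongr
              exact hint A hA
          _ ≤ δ ^ (((2 * M * N : ℝ)⁻¹) * N) := ENNReal.rpow_le_rpow_of_exponent_ge hδ hexp
          _ = ε ^ N := by rw [ENNReal.rpow_mul, ENNReal.rpow_natCast]
    _ = ε ^ (γ.card * N) := by rw [Finset.prod_const, ← pow_mul, mul_comm]
    _ ≤ _ := pow_le_pow_right_of_le_one' hε1 (card_clusterSupport_le hγ)

end ClusterBound

end ShortTimeGibbs

end

/-! ### The cluster estimate. -/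

theorem mainTheorem3 (d : ℕ)
    (W : Measure C(ℝ≥0, ℝ)) (hW : ShortTimeGibbs.IsWienerMeasure W)
    (φ : Finset (ShortTimeGibbs.Site d) → ShortTimeGibbs.Config d → ℝ)
    (hφ : ShortTimeGibbs.IsInteraction φ)
    (hφ_range : ShortTimeGibbs.HasFiniteRange φ)
    (hφ_lip : ShortTimeGibbs.IsLipschitzInteraction φ)
    (𝒩 : Finset (ShortTimeGibbs.Site d))
    (b₀ : ℝ≥0 → ShortTimeGibbs.PathSpace d → ℝ)
    (hb : ShortTimeGibbs.IsAdmissibleDrift 𝒩 b₀)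
    (N : ℕ) (hN_drift : 𝒩.card ≤ N)
    (hN_int : ∀ A : Finset (ShortTimeGibbs.Site d), N < A.card → ∀ x, φ A x = 0)
    (p : ℕ) (hp : IsLeast {q : ℕ | Odd q ∧ N < q} p)
    (F : ℝ≥0 → ShortTimeGibbs.PathSpace d → ℝ)
    (hF : ∀ t : ℝ≥0, 0 < t → ∀ x : ShortTimeGibbs.Config d,
      ShortTimeGibbs.IsReversedGirsanov (ShortTimeGibbs.wienerFrom W x) b₀ t (F t))
    (hF_exp : ShortTimeGibbs.ExponentialMomentCondition W F p) :
    ∃ lam : ℝ≥0 → ℝ, (∀ t, 0 < lam t) ∧ Tendsto lam (𝓝[>] 0) (𝓝 0) ∧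
      ∃ t₀ : ℝ≥0, 0 < t₀ ∧ ∀ t : ℝ≥0, 0 < t → t ≤ t₀ →
        ∀ (Λ : Finset (ShortTimeGibbs.Site d))
          (γ : Finset (Finset (ShortTimeGibbs.Site d))),
          ShortTimeGibbs.IsCluster N γ → (∀ A ∈ γ, A ⊆ Λ) →
          ∀ x : ShortTimeGibbs.Config d,
            Integrable (ShortTimeGibbs.clusterFunctional 𝒩 F φ t γ)
                (ShortTimeGibbs.wienerFrom W x) ∧
              |ShortTimeGibbs.clusterWeight W 𝒩 F φ t γ x| ≤
                lam t ^ (ShortTimeGibbs.clusterSupport γ).card := by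
  classical
  have hWprob := hW.isProbabilityMeasure
  obtain ⟨B, -, hB⟩ := hφ.exists_uniform_bound
  obtain ⟨C, hC0, hC⟩ := hφ.exists_uniform_lipschitz hφ_range hφ_lip
  obtain ⟨r, -, hr⟩ := hφ_range
  have hNp : N < p := hp.1.2
  have hN0 : 0 < N := (Finset.card_pos.2 ⟨0, hb.origin_mem⟩).trans_le hN_drift
  set M := max p (ShortTimeGibbs.subsetsOfCube d r).card with hM
  have hpM : p ≤ M := le_max_left _ _
  have hM0 : 0 < M := (Nat.zero_le N).trans_lt (hNp.trans_le hpM)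
  set K := max (ShortTimeGibbs.factorConst B p) (ShortTimeGibbs.factorConst B M) with hK
  let δ : ℝ≥0 → ℝ≥0∞ := fun t => ENNReal.ofReal K *
    (ShortTimeGibbs.girsanovMoment W F p t + ENNReal.ofReal C * (N * t))
  have hδ : Tendsto δ (𝓝[>] 0) (𝓝 0) := by
    have h1 : Tendsto (ShortTimeGibbs.girsanovMoment W F p) (𝓝[>] 0) (𝓝 0) := hF_exp
    have h2 : Tendsto (fun t : ℝ≥0 => ENNReal.ofReal C * (N * (t : ℝ≥0∞))) (𝓝[>] 0) (𝓝 0) := by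
      have h3 : Tendsto (fun t : ℝ≥0 => (t : ℝ≥0∞)) (𝓝[>] 0) (𝓝 0) :=
        (ENNReal.continuous_coe.tendsto 0).mono_left nhdsWithin_le_nhds
      have h4 := ENNReal.Tendsto.const_mul (a := (N : ℝ≥0∞)) h3 (Or.inr (ENNReal.natCast_ne_top N))
      rw [mul_zero] at h4
      have h5 := ENNReal.Tendsto.const_mul (a := ENNReal.ofReal C) h4
        (Or.inr ENNReal.ofReal_ne_top)
      rwa [mul_zero] at h5
    have h6 := ENNReal.Tendsto.const_mul (a := ENNReal.ofReal K) (h1.add h2)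
      (Or.inr ENNReal.ofReal_ne_top)
    rwa [add_zero, mul_zero] at h6
  have hκ : (0 : ℝ) < (2 * M * N : ℝ)⁻¹ := by positivity
  obtain ⟨lam, hlam_pos, hlam, t₀, ht₀, hlam_le⟩ :=
    ShortTimeGibbs.exists_pos_tendsto_zero_of_rpow hδ hκ
  refine ⟨lam, hlam_pos, hlam, t₀, ht₀, fun t ht htt Λ γ hγ _ x => ?_⟩
  obtain ⟨hδ1, hδlam⟩ := hlam_le t ht htt
  -- A set of large diameter that is not a translate of `𝒩` has potential `0` and kills the whole
  -- product. Discarding this case is what bounds the number of remaining sets at each site.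
  by_cases hvanish : ∃ A ∈ γ, (¬ ∃ k, A = ShortTimeGibbs.translate k 𝒩) ∧
      r < Metric.diam (A : Set (ShortTimeGibbs.Site d))
  · obtain ⟨A, hA, hAk, hAr⟩ := hvanish
    have hzero : ShortTimeGibbs.clusterFunctional 𝒩 F φ t γ = fun _ => 0 := by
      funext ω
      refine Finset.prod_eq_zero hA ?_
      rw [ShortTimeGibbs.pathPotential, ShortTimeGibbs.girsanovPotential_of_not_translate hAk,
        hr A hAr, hr A hAr]
      simp
    rw [ShortTimeGibbs.clusterWeight, hzero]
    exact ⟨integrable_zero _ _ _, by simpa using pow_nonneg (hlam_pos t).le _⟩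
  push Not at hvanish
  let n : Finset (ShortTimeGibbs.Site d) → ℕ := fun A =>
    if ∃ k, A = ShortTimeGibbs.translate k 𝒩 then p else M
  have hn0 (A) : n A ≠ 0 := by simp only [n]; split_ifs <;> omega
  have hnM (A) : n A ≤ M := by simp only [n]; split_ifs <;> omega
  have hnK (A) : ShortTimeGibbs.factorConst B (n A) ≤ K := by
    simp only [n]
    split_ifs
    exacts [le_max_left _ _, le_max_right _ _]
  have hfactor : ∀ A ∈ γ, ∃ h : ShortTimeGibbs.PathSpace d → ℝ, Measurable h ∧
      DependsOn h (A : Set (ShortTimeGibbs.Site d)) ∧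
      ((fun ω => Real.exp (-ShortTimeGibbs.pathPotential 𝒩 F φ t A ω) - 1)
        =ᵐ[ShortTimeGibbs.wienerFrom W x] h) ∧
      ∫⁻ ω, ENNReal.ofReal (h ω ^ (2 * n A)) ∂ShortTimeGibbs.wienerFrom W x ≤ δ t := by
    intro A hA
    have hAne := hγ.mem_nonempty A hA
    obtain ⟨h, hm, hd, hae, hint⟩ := ShortTimeGibbs.exists_factor_version hW hφ hφ_lip hC0 hb
      (hF t ht) (p := p) (n := n A) (hB A hAne) (hC A hAne) (hγ.card_le A hA) (hn0 A)
      (fun hAk => if_pos hAk) x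
    refine ⟨h, hm, hd, hae, hint.trans ?_⟩
    exact mul_le_mul_left (ENNReal.ofReal_le_ofReal (hnK A)) _
  choose! h hm hd hae hint using hfactor
  have hversion : ShortTimeGibbs.clusterFunctional 𝒩 F φ t γ =ᵐ[ShortTimeGibbs.wienerFrom W x]
      fun ω => ∏ A ∈ γ, h A ω := by
    have hall := (ae_ball_iff (μ := ShortTimeGibbs.wienerFrom W x) γ.countable_toSet).2 hae
    filter_upwards [hall] with ω hω
    exact Finset.prod_congr rfl hω
  have hbound := ShortTimeGibbs.lintegral_enorm_prod_le x hγ hN0 hm hd (fun A _ => hn0 A)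
    (fun A _ => hnM A)
    (ShortTimeGibbs.sum_exponents_le_one (hN_drift.trans_lt hNp) hM0 (le_max_right _ _)
      (fun A => ∃ k, A = ShortTimeGibbs.translate k 𝒩) (fun _ => Iff.rfl) γ
      fun A hA hAk => hvanish A hA (not_exists.1 hAk)) hδ1 hint
  have hbound' : ∫⁻ ω, ‖∏ A ∈ γ, h A ω‖ₑ ∂ShortTimeGibbs.wienerFrom W x ≤
      ENNReal.ofReal (lam t ^ (ShortTimeGibbs.clusterSupport γ).card) := by
    rw [ENNReal.ofReal_pow (hlam_pos t).le]
    exact hbound.trans (pow_le_pow_left' hδlam _)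
  have hprod : Measurable fun ω => ∏ A ∈ γ, h A ω := Finset.measurable_fun_prod _ hm
  -- `F` is not assumed measurable, so integrability is transferred from the measurable version.
  refine ⟨Integrable.congr ⟨hprod.aestronglyMeasurable,
    hbound'.trans_lt ENNReal.ofReal_lt_top⟩ hversion.symm, ?_⟩
  rw [ShortTimeGibbs.clusterWeight, integral_congr_ae hversion, ← Real.norm_eq_abs]
  refine (ENNReal.ofReal_le_ofReal_iff (pow_nonneg (hlam_pos t).le _)).1 ?_
  rw [ofReal_norm]
  exact (enorm_integral_le_lintegral_enorm _).trans hbound'
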